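/- Let $N\ge 2$, let $\Omega\subset\mathbb{R}^N$ be a bounded domain (a bounded, connected, nonempty open set; no regularity of $\partial\Omega$ is needed, so smooth bounded domains are included), and let $p,q\in(N,\infty)$ with $p\neq q$. For $m>N$ let $W_0^{1,m}(\Omega)$ be the closure of $C_c^\infty(\Omega)$ in $W^{1,m}(\Omega)$; the elements of $W_0^{1,m}(\Omega)$ have (unique) representatives that are continuous on $\overline\Omega$, and point values below are those of these representatives. Put $X_{p,q}:=W_0^{1,\max\{p,q\}}(\Omega)$, write $\|\cdot\|_s$ for the norm of $L^s(\Omega)$, and let $$\lambda_\infty(p):=\inf\left\{\frac{\|\nabla v\|_p^p}{\|v\|_\infty^p}: v\in W_0^{1,p}(\Omega)\setminus\{0\}\right\},\qquad \lambda>\lambda_\infty(p).$$ For $u\in X_{p,q}$ let $$J_\lambda(u):=\frac1p\|\nabla u\|_p^p+\frac1q\|\nabla u\|_q^q-\frac{\lambda}{p}\|u\|_\infty^p,$$ $$\mathcal N_{\lambda,\infty}:=\left\{u\in X_{p,q}\setminus\{0\}:\ \|\nabla u\|_p^p+\|\nabla u\|_q^q=\lambda\|u\|_\infty^p\right\}.$$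 Let $u$ be a least energy solution of $$-(\Delta_p+\Delta_q)u=\lambda|u(x_u)|^{p-2}u(x_u)\,\delta_{x_u}\ \text{ in }\Omega,\qquad u=0\ \text{ on }\partial\Omega,$$ that is, $u$ minimizes $J_\lambda$ on $X_{p,q}$ if $p<q$, and $u\in\mathcal N_{\lambda,\infty}$ minimizes $J_\lambda$ on $\mathcal N_{\lambda,\infty}$ if $q<p$. Then $u$ is a weak solution of this problem: there is a point $x_u\in\Omega$ with $|u(x_u)|=\|u\|_\infty$ such that $$\int_\Omega\left(|\nabla u|^{p-2}+|\nabla u|^{q-2}\right)\nabla u\cdot\nabla v\,dx=\lambda|u(x_u)|^{p-2}u(x_u)v(x_u)\qquad\text{for all } v\in X_{p,q}.$$ Moreover, $x_u$ is the only point of $\overline\Omega$ at which $|u|$ attains its maximum $\|u\|_\infty$. -/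

import Mathlib

open MeasureTheory Set Filter Topology
open scoped ContDiff

noncomputable section

namespace DiracPQ

/-- Test functions on `Ω`: smooth functions with compact support contained in `Ω`. -/
def IsTestFunction {N : ℕ} (Ω : Set (EuclideanSpace ℝ (Fin N)))
    (φ : EuclideanSpace ℝ (Fin N) → ℝ) : Prop :=
  ContDiff ℝ ∞ φ ∧ HasCompactSupport φ ∧ tsupport φ ⊆ Ω

/-- `G` is a weak gradient of `u` in `Ω`: both are locally integrable in `Ω` and
`∫_Ω u ∇φ dx = - ∫_Ω φ G dx` (an identity of vectors) for every test function `φ`. -/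
def IsWeakGradient {N : ℕ} (Ω : Set (EuclideanSpace ℝ (Fin N)))
    (u : EuclideanSpace ℝ (Fin N) → ℝ)
    (G : EuclideanSpace ℝ (Fin N) → EuclideanSpace ℝ (Fin N)) : Prop :=
  LocallyIntegrableOn u Ω ∧ LocallyIntegrableOn G Ω ∧
    ∀ φ : EuclideanSpace ℝ (Fin N) → ℝ, IsTestFunction Ω φ →
      ∫ x in Ω, u x • gradient φ x = -∫ x in Ω, φ x • G x

open Classical in
/-- The weak gradient of `u` in `Ω` (unique up to null subsets of `Ω`), and `0` if there is none.
It is only used for functions that have a weak gradient. -/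
def weakGrad {N : ℕ} (Ω : Set (EuclideanSpace ℝ (Fin N)))
    (u : EuclideanSpace ℝ (Fin N) → ℝ) : EuclideanSpace ℝ (Fin N) → EuclideanSpace ℝ (Fin N) :=
  if h : ∃ G, IsWeakGradient Ω u G then h.choose else 0

/-- The Sobolev space `W₀^{1,m}(Ω)`, the closure of the test functions in the norm of
`W^{1,m}(Ω)`. Its elements are written as functions on `ℝ^N`; only their almost everywhere
class in `Ω` plays a role. No continuity is required. -/
def sobolevZero {N : ℕ} (Ω : Set (EuclideanSpace ℝ (Fin N))) (m : ℝ) :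
    Set (EuclideanSpace ℝ (Fin N) → ℝ) :=
  {u | MemLp u (ENNReal.ofReal m) (volume.restrict Ω) ∧
    (∃ G, IsWeakGradient Ω u G) ∧
    MemLp (weakGrad Ω u) (ENNReal.ofReal m) (volume.restrict Ω) ∧
    ∃ φ : ℕ → EuclideanSpace ℝ (Fin N) → ℝ, (∀ n, IsTestFunction Ω (φ n)) ∧
      Tendsto (fun n => eLpNorm (fun x => φ n x - u x)
        (ENNReal.ofReal m) (volume.restrict Ω)) atTop (𝓝 0) ∧
      Tendsto (fun n => eLpNorm (fun x => gradient (φ n) x - weakGrad Ω u x)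
        (ENNReal.ofReal m) (volume.restrict Ω)) atTop (𝓝 0)}

/-- `X_{p,q} = W₀^{1,max{p,q}}(Ω)`. -/
def spaceX {N : ℕ} (Ω : Set (EuclideanSpace ℝ (Fin N))) (p q : ℝ) :
    Set (EuclideanSpace ℝ (Fin N) → ℝ) :=
  sobolevZero Ω (max p q)

/-- `‖∇u‖_s`, the norm of the weak gradient in `L^s(Ω)`, for a real exponent `s`. -/
def gradNorm {N : ℕ} (Ω : Set (EuclideanSpace ℝ (Fin N))) (s : ℝ)
    (u : EuclideanSpace ℝ (Fin N) → ℝ) : ℝ :=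
  (eLpNorm (weakGrad Ω u) (ENNReal.ofReal s) (volume.restrict Ω)).toReal

/-- `‖u‖_∞`, the norm in `L^∞(Ω)`. -/
def supNorm {N : ℕ} (Ω : Set (EuclideanSpace ℝ (Fin N)))
    (u : EuclideanSpace ℝ (Fin N) → ℝ) : ℝ :=
  (eLpNorm u ⊤ (volume.restrict Ω)).toReal

/-- `u` is the zero element: it vanishes almost everywhere in `Ω`. -/
def IsZeroOn {N : ℕ} (Ω : Set (EuclideanSpace ℝ (Fin N)))
    (u : EuclideanSpace ℝ (Fin N) → ℝ) : Prop :=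
  u =ᵐ[volume.restrict Ω] 0

/-- `λ_∞(m)`, the infimum of `‖∇v‖_m^m / ‖v‖_∞^m` over the nonzero `v ∈ W₀^{1,m}(Ω)`. -/
def lambdaInf {N : ℕ} (Ω : Set (EuclideanSpace ℝ (Fin N))) (m : ℝ) : ℝ :=
  sInf {c | ∃ v ∈ sobolevZero Ω m, ¬ IsZeroOn Ω v ∧
    c = gradNorm Ω m v ^ m / supNorm Ω v ^ m}

/-- The energy functional `J_λ`. -/
def energy {N : ℕ} (Ω : Set (EuclideanSpace ℝ (Fin N))) (p q lam : ℝ)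
    (u : EuclideanSpace ℝ (Fin N) → ℝ) : ℝ :=
  1 / p * gradNorm Ω p u ^ p + 1 / q * gradNorm Ω q u ^ q - lam / p * supNorm Ω u ^ p

/-- The Nehari set associated with `J_λ`. -/
def nehari {N : ℕ} (Ω : Set (EuclideanSpace ℝ (Fin N))) (p q lam : ℝ) :
    Set (EuclideanSpace ℝ (Fin N) → ℝ) :=
  {u | u ∈ spaceX Ω p q ∧ ¬ IsZeroOn Ω u ∧
    gradNorm Ω p u ^ p + gradNorm Ω q u ^ q = lam * supNorm Ω u ^ p}

/-- Least energy solutions (for `p ≠ q`): minimizers of `J_λ` on the whole space if `p < q`,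
and on the Nehari set if `q < p`. -/
def IsLeastEnergySolution {N : ℕ} (Ω : Set (EuclideanSpace ℝ (Fin N))) (p q lam : ℝ)
    (u : EuclideanSpace ℝ (Fin N) → ℝ) : Prop :=
  (p < q ∧ u ∈ spaceX Ω p q ∧ IsMinOn (energy Ω p q lam) (spaceX Ω p q) u) ∨
  (q < p ∧ u ∈ nehari Ω p q lam ∧ IsMinOn (energy Ω p q lam) (nehari Ω p q lam) u)

/-- `w` is a representative of `u` that is continuous on the closure of `Ω`. For `Ω` open, the
values of such a `w` on the closure of `Ω` are determined by `u`. -/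
def IsContRep {N : ℕ} (Ω : Set (EuclideanSpace ℝ (Fin N)))
    (u w : EuclideanSpace ℝ (Fin N) → ℝ) : Prop :=
  ContinuousOn w (closure Ω) ∧ w =ᵐ[volume.restrict Ω] u

/-- The integrand `(|∇u|^{p-2} + |∇u|^{q-2}) ∇u · ∇v`. -/
def pqIntegrand {N : ℕ} (Ω : Set (EuclideanSpace ℝ (Fin N))) (p q : ℝ)
    (u v : EuclideanSpace ℝ (Fin N) → ℝ) (x : EuclideanSpace ℝ (Fin N)) : ℝ :=
  (‖weakGrad Ω u x‖ ^ (p - 2) + ‖weakGrad Ω u x‖ ^ (q - 2)) *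
    inner ℝ (weakGrad Ω u x) (weakGrad Ω v x)

/-- Weak solutions of `-(Δ_p + Δ_q) u = λ |u(x_u)|^{p-2} u(x_u) δ_{x_u}` in `Ω`, `u = 0` on `∂Ω`,
where `x_u ∈ Ω` is a maximum point of `|u|`. Point values are those of the representatives
that are continuous on the closure of `Ω`, whose existence is part of the definition. -/
def IsWeakSolution {N : ℕ} (Ω : Set (EuclideanSpace ℝ (Fin N))) (p q lam : ℝ)
    (u : EuclideanSpace ℝ (Fin N) → ℝ) : Prop :=
  u ∈ spaceX Ω p q ∧
  ∃ w, IsContRep Ω u w ∧ ∃ x₀ ∈ Ω, |w x₀| = supNorm Ω u ∧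
    ∀ v ∈ spaceX Ω p q, ∃ z, IsContRep Ω v z ∧
      IntegrableOn (pqIntegrand Ω p q u v) Ω ∧
      ∫ x in Ω, pqIntegrand Ω p q u v x = lam * (|w x₀| ^ (p - 2) * w x₀ * z x₀)

end DiracPQ

end

/-!
Let `u` be a least energy solution and `x₀` a point at which `|u|` is maximal. The sup norm is not
differentiable, but it enters the energy with a negative sign, and `λ |v(x₀)| ^ p ≤ λ ‖v‖_∞ ^ p`
with equality at `v = u`. So, along each line `t ↦ u + t v`, the functional that has `|v(x₀)|` in
place of `‖v‖_∞` is still minimal at `u`. It is differentiable, and its stationarity is the weak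
equation with the Dirac mass at `x₀` (`DiracPQ.integral_eq_of_abs_eq_supNorm`). This holds for
*every* maximum point `x₀`. If there were two of them, then testing with a smooth function that is
`1` at one and `0` at the other would give `λ |u(x₀)| ^ (p - 2) u(x₀) = 0`, whereas `u ≠ 0`.

For `p < q` the minimality is that of the energy on the whole space, and `λ > λ_∞(p)` makes the
minimum negative, so `u ≠ 0` (`DiracPQ.supNorm_pos_of_isMinOn_energy`). For `q < p` a function
with `‖∇v‖_p ^ p < λ ‖v‖_∞ ^ p` is scaled into the Nehari set, on which the energy is a multiple of
`‖∇v‖_q ^ q`. Minimality of `u` thus says that `(‖∇v‖_q ^ q) ^ p` is bounded below by a multiple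
of `(λ ‖v‖_∞ ^ p - ‖∇v‖_p ^ p) ^ q`, with equality at `v = u`
(`DiracPQ.gradNorm_rpow_le_of_isMinOn_nehari`), and this inequality can be differentiated in the
same way.

Point values make sense because of Morrey's bound `‖φ‖_∞ ≤ C ‖∇φ‖_m` for test functions and
`m > N` (`DiracPQ.exists_enorm_le_mul_eLpNorm_gradient`): convergence in `W^{1,m}` is uniform
convergence, so every element of `W₀^{1,m}` has a representative that is continuous on `ℝ^N` and
vanishes outside `Ω` (`DiracPQ.exists_tendstoUniformly`).
-/

namespace DiracPQ

variable {N : ℕ} {Ω : Set (EuclideanSpace ℝ (Fin N))}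

/-! ### Test functions -/

namespace IsTestFunction

variable {φ ψ : EuclideanSpace ℝ (Fin N) → ℝ}

lemma add (hφ : IsTestFunction Ω φ) (hψ : IsTestFunction Ω ψ) :
    IsTestFunction Ω (fun x => φ x + ψ x) :=
  ⟨hφ.1.add hψ.1, hφ.2.1.add hψ.2.1,
    (tsupport_add φ ψ).trans (union_subset hφ.2.2 hψ.2.2)⟩

lemma const_mul (hφ : IsTestFunction Ω φ) (c : ℝ) : IsTestFunction Ω (fun x => c * φ x) :=
  ⟨contDiff_const.mul hφ.1, hφ.2.1.mul_left (f := fun _ => c),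
    (tsupport_mul_subset_right (f := fun _ => c) (g := φ)).trans hφ.2.2⟩

lemma differentiable (hφ : IsTestFunction Ω φ) : Differentiable ℝ φ :=
  hφ.1.differentiable (by simp)

lemma continuous_gradient (hφ : IsTestFunction Ω φ) : Continuous (gradient φ) :=
  (InnerProductSpace.toDual ℝ _).symm.continuous.comp (hφ.1.continuous_fderiv (by simp))

lemma tsupport_gradient (φ : EuclideanSpace ℝ (Fin N) → ℝ) :
    tsupport (gradient φ) ⊆ tsupport φ := by
  refine closure_minimal (fun x hx => ?_) isClosed_closure
  by_contra h
  refine hx ?_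
  have : fderiv ℝ φ x = 0 := by
    by_contra h'
    exact h (support_fderiv_subset ℝ h')
  simp [gradient, this]

lemma hasCompactSupport_gradient (hφ : IsTestFunction Ω φ) : HasCompactSupport (gradient φ) :=
  hφ.2.1.of_isClosed_subset isClosed_closure (tsupport_gradient φ)

lemma eq_zero (hφ : IsTestFunction Ω φ) {x : EuclideanSpace ℝ (Fin N)} (hx : x ∉ Ω) : φ x = 0 :=
  image_eq_zero_of_notMem_tsupport fun h => hx (hφ.2.2 h)

lemma gradient_eq_zero (hφ : IsTestFunction Ω φ) {x : EuclideanSpace ℝ (Fin N)} (hx : x ∉ Ω) :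
    gradient φ x = 0 :=
  image_eq_zero_of_notMem_tsupport fun h => hx (hφ.2.2 (tsupport_gradient φ h))

lemma gradient_add (hφ : IsTestFunction Ω φ) (hψ : IsTestFunction Ω ψ)
    (x : EuclideanSpace ℝ (Fin N)) :
    gradient (fun y => φ y + ψ y) x = gradient φ x + gradient ψ x := by
  simp only [gradient]
  rw [fderiv_fun_add (hφ.differentiable x) (hψ.differentiable x), map_add]

lemma gradient_const_mul (hφ : IsTestFunction Ω φ) (c : ℝ) (x : EuclideanSpace ℝ (Fin N)) :
    gradient (fun y => c * φ y) x = c • gradient φ x := by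
  simp only [gradient]
  rw [fderiv_const_mul (hφ.differentiable x)]
  simp

lemma memLp (hφ : IsTestFunction Ω φ) (m : ENNReal) : MemLp φ m (volume.restrict Ω) :=
  (hφ.1.continuous.memLp_of_hasCompactSupport hφ.2.1).restrict Ω

lemma memLp_gradient (hφ : IsTestFunction Ω φ) (m : ENNReal) :
    MemLp (gradient φ) m (volume.restrict Ω) :=
  (hφ.continuous_gradient.memLp_of_hasCompactSupport hφ.hasCompactSupport_gradient).restrict Ω

/-- Integration by parts for smooth functions with compact support. -/
lemma isWeakGradient (hφ : IsTestFunction Ω φ) : IsWeakGradient Ω φ (gradient φ) := by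
  refine ⟨(hφ.1.continuous.locallyIntegrable).locallyIntegrableOn _,
    (hφ.continuous_gradient.locallyIntegrable).locallyIntegrableOn _, fun ψ hψ => ?_⟩
  rw [setIntegral_eq_integral_of_forall_compl_eq_zero
      (fun x hx => by rw [hφ.eq_zero hx, zero_smul]),
    setIntegral_eq_integral_of_forall_compl_eq_zero
      (fun x hx => by rw [hψ.eq_zero hx, zero_smul])]
  have h1 : Integrable (fun x => φ x • gradient ψ x) :=
    (hφ.1.continuous.smul hψ.continuous_gradient).integrable_of_hasCompactSupport
      (hφ.2.1.smul_right)
  have h2 : Integrable (fun x => ψ x • gradient φ x) :=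
    (hψ.1.continuous.smul hφ.continuous_gradient).integrable_of_hasCompactSupport
      (hψ.2.1.smul_right)
  have h3 : Integrable (fun x => φ x * ψ x) :=
    (hφ.1.continuous.mul hψ.1.continuous).integrable_of_hasCompactSupport hφ.2.1.mul_right
  refine ext_inner_left ℝ fun v => ?_
  have e1 : ∀ x, inner ℝ v (φ x • gradient ψ x) = φ x * fderiv ℝ ψ x v := fun x => by
    rw [inner_smul_right, real_inner_comm]; simp [gradient]
  have e2 : ∀ x, inner ℝ v (ψ x • gradient φ x) = fderiv ℝ φ x v * ψ x := fun x => by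
    rw [inner_smul_right, real_inner_comm, mul_comm]; simp [gradient]
  rw [inner_neg_right, ← integral_inner (𝕜 := ℝ) h1,
    ← integral_inner (𝕜 := ℝ) h2]
  have h1' := Integrable.const_inner (𝕜 := ℝ) v h1
  have h2' := Integrable.const_inner (𝕜 := ℝ) v h2
  simp only [e1] at h1' ⊢
  simp only [e2] at h2' ⊢
  exact integral_mul_fderiv_eq_neg_fderiv_mul_of_integrable h2' h1' h3
    (fun x _ => hφ.differentiable x) (fun x _ => hψ.differentiable x)

/-- A locally integrable function may be integrated against a test function. -/
lemma integrableOn_smul {F : Type*} [NormedAddCommGroup F] [NormedSpace ℝ F]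
    {G : EuclideanSpace ℝ (Fin N) → F} (hφ : IsTestFunction Ω φ)
    (hG : LocallyIntegrableOn G Ω) : IntegrableOn (fun x => φ x • G x) Ω := by
  have h := (hG.integrableOn_compact_subset hφ.2.2 hφ.2.1).continuousOn_smul
    hφ.1.continuous.continuousOn hφ.2.1
  have h' : IntegrableOn (fun x => φ x • G x) univ :=
    h.of_forall_sdiff_eq_zero MeasurableSet.univ fun x hx => by
      rw [image_eq_zero_of_notMem_tsupport hx.2, zero_smul]
  exact h'.mono_set (subset_univ _)

/-- A locally integrable function may be integrated against the gradient of a test function. -/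
lemma integrableOn_smul_gradient {u : EuclideanSpace ℝ (Fin N) → ℝ} (hφ : IsTestFunction Ω φ)
    (hu : LocallyIntegrableOn u Ω) : IntegrableOn (fun x => u x • gradient φ x) Ω := by
  have h := (hu.integrableOn_compact_subset hφ.2.2 hφ.2.1).smul_continuousOn
    hφ.continuous_gradient.continuousOn hφ.2.1
  have h' : IntegrableOn (fun x => u x • gradient φ x) univ :=
    h.of_forall_sdiff_eq_zero MeasurableSet.univ fun x hx => by
      rw [image_eq_zero_of_notMem_tsupport fun h => hx.2 (tsupport_gradient φ h), smul_zero]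
  exact h'.mono_set (subset_univ _)

/-- A point of an open set is separated from any other point by a test function. -/
lemma exists_separating (hΩ : IsOpen Ω) {x y : EuclideanSpace ℝ (Fin N)} (hx : x ∈ Ω)
    (hxy : x ≠ y) : ∃ φ, IsTestFunction Ω φ ∧ φ x = 1 ∧ φ y = 0 := by
  obtain ⟨f, hs, hc, hf, -, hx1⟩ := exists_contDiff_tsupport_subset (n := ⊤)
    ((hΩ.inter isOpen_ne).mem_nhds ⟨hx, hxy⟩ : Ω ∩ {z | z ≠ y} ∈ 𝓝 x)
  exact ⟨f, ⟨hf, hc, hs.trans inter_subset_left⟩, hx1,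
    image_eq_zero_of_notMem_tsupport fun h => (hs h).2 rfl⟩

end IsTestFunction

/-! ### Weak gradients -/

namespace IsWeakGradient

variable {u v : EuclideanSpace ℝ (Fin N) → ℝ}
  {G H : EuclideanSpace ℝ (Fin N) → EuclideanSpace ℝ (Fin N)}

lemma add (hu : IsWeakGradient Ω u G) (hv : IsWeakGradient Ω v H) :
    IsWeakGradient Ω (fun x => u x + v x) (fun x => G x + H x) := by
  refine ⟨hu.1.add hv.1, hu.2.1.add hv.2.1, fun φ hφ => ?_⟩
  simp only [add_smul, smul_add]
  rw [integral_add (hφ.integrableOn_smul_gradient hu.1) (hφ.integrableOn_smul_gradient hv.1),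
    integral_add (hφ.integrableOn_smul hu.2.1) (hφ.integrableOn_smul hv.2.1),
    hu.2.2 φ hφ, hv.2.2 φ hφ, neg_add]

lemma const_mul (hu : IsWeakGradient Ω u G) (c : ℝ) :
    IsWeakGradient Ω (fun x => c * u x) (fun x => c • G x) := by
  refine ⟨hu.1.smul c, hu.2.1.smul c, fun φ hφ => ?_⟩
  have e : ∀ x, φ x • c • G x = c • φ x • G x := fun x => smul_comm _ _ _
  simp only [e, mul_smul]
  rw [integral_smul, integral_smul, hu.2.2 φ hφ, smul_neg]

/-- Uniqueness of weak gradients, by the fundamental lemma of the calculus of variations. -/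
lemma ae_eq (hΩ : IsOpen Ω) (hG : IsWeakGradient Ω u G) (hH : IsWeakGradient Ω u H) :
    G =ᵐ[volume.restrict Ω] H := by
  have h := hΩ.ae_eq_zero_of_integral_contDiff_smul_eq_zero (μ := volume)
    (hG.2.1.sub hH.2.1) fun φ h1 h2 h3 => by
      have hφ : IsTestFunction Ω φ := ⟨h1, h2, h3⟩
      rw [← setIntegral_eq_integral_of_forall_compl_eq_zero (s := Ω)
        (fun x hx => by rw [hφ.eq_zero hx, zero_smul])]
      simp only [Pi.sub_apply, smul_sub]
      rw [integral_sub (hφ.integrableOn_smul hG.2.1) (hφ.integrableOn_smul hH.2.1), sub_eq_zero,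
        ← neg_inj, ← hG.2.2 φ hφ, ← hH.2.2 φ hφ]
  rw [EventuallyEq, ae_restrict_iff' hΩ.measurableSet]
  filter_upwards [h] with x hx hxΩ
  exact sub_eq_zero.1 (hx hxΩ)

lemma isWeakGradient_weakGrad (hG : IsWeakGradient Ω u G) :
    IsWeakGradient Ω u (weakGrad Ω u) := by
  have h : ∃ G, IsWeakGradient Ω u G := ⟨G, hG⟩
  rw [weakGrad, dif_pos h]
  exact h.choose_spec

lemma weakGrad_ae_eq (hΩ : IsOpen Ω) (hG : IsWeakGradient Ω u G) :
    weakGrad Ω u =ᵐ[volume.restrict Ω] G :=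
  hG.isWeakGradient_weakGrad.ae_eq hΩ hG

end IsWeakGradient

/-! ### The space `W₀^{1,m}` -/

section sobolevZero

variable {u v : EuclideanSpace ℝ (Fin N) → ℝ} {m : ℝ}

lemma isWeakGradient_of_mem_sobolevZero (hu : u ∈ sobolevZero Ω m) :
    IsWeakGradient Ω u (weakGrad Ω u) :=
  let ⟨_, hG⟩ := hu.2.1
  hG.isWeakGradient_weakGrad

lemma weakGrad_add (hΩ : IsOpen Ω) (hu : u ∈ sobolevZero Ω m) (hv : v ∈ sobolevZero Ω m) :
    weakGrad Ω (fun x => u x + v x) =ᵐ[volume.restrict Ω]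
      fun x => weakGrad Ω u x + weakGrad Ω v x :=
  ((isWeakGradient_of_mem_sobolevZero hu).add
    (isWeakGradient_of_mem_sobolevZero hv)).weakGrad_ae_eq hΩ

lemma weakGrad_const_mul (hΩ : IsOpen Ω) (hu : u ∈ sobolevZero Ω m) (c : ℝ) :
    weakGrad Ω (fun x => c * u x) =ᵐ[volume.restrict Ω] fun x => c • weakGrad Ω u x :=
  ((isWeakGradient_of_mem_sobolevZero hu).const_mul c).weakGrad_ae_eq hΩ

lemma IsTestFunction.mem_sobolevZero (hΩ : IsOpen Ω) {φ : EuclideanSpace ℝ (Fin N) → ℝ}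
    (hφ : IsTestFunction Ω φ) (m : ℝ) : φ ∈ sobolevZero Ω m := by
  have h := hφ.isWeakGradient.weakGrad_ae_eq hΩ
  refine ⟨hφ.memLp _, ⟨_, hφ.isWeakGradient⟩, (memLp_congr_ae h).2 (hφ.memLp_gradient _),
    fun _ => φ, fun _ => hφ, by simp, ?_⟩
  have : eLpNorm (fun x => gradient φ x - weakGrad Ω φ x) (ENNReal.ofReal m)
      (volume.restrict Ω) = 0 := by
    rw [eLpNorm_congr_ae (g := 0), eLpNorm_zero]
    filter_upwards [h] with x hx
    simp [hx]
  simp [this]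

lemma add_mem_sobolevZero (hΩ : IsOpen Ω) (hm : 1 ≤ m) (hu : u ∈ sobolevZero Ω m)
    (hv : v ∈ sobolevZero Ω m) : (fun x => u x + v x) ∈ sobolevZero Ω m := by
  have hm' : 1 ≤ ENNReal.ofReal m := by simpa using ENNReal.ofReal_le_ofReal hm
  have h := weakGrad_add hΩ hu hv
  have hWu := (isWeakGradient_of_mem_sobolevZero hu)
  have hWv := (isWeakGradient_of_mem_sobolevZero hv)
  obtain ⟨hu1, -, hu2, φ, hφ, hφ1, hφ2⟩ := hu
  obtain ⟨hv1, -, hv2, ψ, hψ, hψ1, hψ2⟩ := hv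
  refine ⟨hu1.add hv1, ⟨_, hWu.add hWv⟩, (memLp_congr_ae h).2 (hu2.add hv2),
    fun n x => φ n x + ψ n x, fun n => (hφ n).add (hψ n), ?_, ?_⟩
  · refine tendsto_of_tendsto_of_tendsto_of_le_of_le tendsto_const_nhds
      (by simpa using hφ1.add hψ1) (fun _ => zero_le) fun n => ?_
    refine le_trans (le_of_eq (congrArg (eLpNorm · _ _) ?_))
      (eLpNorm_add_le (((hφ n).memLp _).sub hu1).1 (((hψ n).memLp _).sub hv1).1 hm')
    ext x
    simp only [Pi.add_apply]
    ring
  · refine tendsto_of_tendsto_of_tendsto_of_le_of_le tendsto_const_nhds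
      (by simpa using hφ2.add hψ2) (fun _ => zero_le) fun n => ?_
    refine le_trans (le_of_eq (eLpNorm_congr_ae ?_))
      (eLpNorm_add_le (((hφ n).memLp_gradient _).sub hu2).1
        (((hψ n).memLp_gradient _).sub hv2).1 hm')
    filter_upwards [h] with x hx
    rw [hx, (hφ n).gradient_add (hψ n)]
    simp only [Pi.add_apply]
    abel

lemma const_mul_mem_sobolevZero (hΩ : IsOpen Ω) (hu : u ∈ sobolevZero Ω m) (c : ℝ) :
    (fun x => c * u x) ∈ sobolevZero Ω m := by
  have h := weakGrad_const_mul hΩ hu c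
  have hWu := (isWeakGradient_of_mem_sobolevZero hu)
  obtain ⟨hu1, -, hu2, φ, hφ, hφ1, hφ2⟩ := hu
  refine ⟨hu1.const_mul c, ⟨_, hWu.const_mul c⟩, (memLp_congr_ae h).2 (hu2.const_smul c),
    fun n x => c * φ n x, fun n => (hφ n).const_mul c, ?_, ?_⟩
  · have e : ∀ n, eLpNorm (fun x => c * φ n x - c * u x) (ENNReal.ofReal m) (volume.restrict Ω)
        = ‖c‖ₑ * eLpNorm (fun x => φ n x - u x) (ENNReal.ofReal m) (volume.restrict Ω) :=
      fun n => by
        rw [← eLpNorm_const_smul]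
        congr 1
        ext x
        simp [mul_sub]
    simp only [e]
    simpa using ENNReal.Tendsto.const_mul hφ1 (Or.inr enorm_ne_top)
  · have e : ∀ n, eLpNorm (fun x => gradient (fun x => c * φ n x) x
          - weakGrad Ω (fun x => c * u x) x) (ENNReal.ofReal m) (volume.restrict Ω)
        = ‖c‖ₑ * eLpNorm (fun x => gradient (φ n) x - weakGrad Ω u x)
          (ENNReal.ofReal m) (volume.restrict Ω) :=
      fun n => by
        rw [← eLpNorm_const_smul]
        refine eLpNorm_congr_ae ?_
        filter_upwards [h] with x hx
        rw [hx, (hφ n).gradient_const_mul]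
        simp [smul_sub]
    simp only [e]
    simpa using ENNReal.Tendsto.const_mul hφ2 (Or.inr enorm_ne_top)

end sobolevZero

/-! ### The Morrey bound for test functions -/

/-- The fundamental theorem of calculus along a segment. -/
lemma enorm_sub_le_lintegral_gradient {φ : EuclideanSpace ℝ (Fin N) → ℝ} (hφ : ContDiff ℝ 1 φ)
    (x y : EuclideanSpace ℝ (Fin N)) :
    ‖φ (x + y) - φ x‖ₑ ≤ ∫⁻ t in Ioc (0 : ℝ) 1, ‖gradient φ (x + t • y)‖ₑ * ‖y‖ₑ := by
  have hd : ∀ t : ℝ, HasDerivAt (fun t : ℝ => φ (x + t • y)) (fderiv ℝ φ (x + t • y) y) t := by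
    intro t
    have h1 : HasDerivAt (fun t : ℝ => x + t • y) y t := by
      simpa using ((hasDerivAt_id t).smul_const y).const_add x
    exact ((hφ.differentiable one_ne_zero) _).hasFDerivAt.comp_hasDerivAt t h1
  have hc : Continuous fun t : ℝ => fderiv ℝ φ (x + t • y) y :=
    ((hφ.continuous_fderiv one_ne_zero).comp (by fun_prop)).clm_apply continuous_const
  have h := intervalIntegral.integral_eq_sub_of_hasDerivAt (a := 0) (b := 1)
    (fun t _ => hd t) (hc.intervalIntegrable _ _)
  simp only [one_smul, zero_smul, add_zero] at h
  rw [← h, intervalIntegral.integral_of_le zero_le_one]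
  refine (enorm_integral_le_lintegral_enorm _).trans (lintegral_mono fun t => ?_)
  have e : fderiv ℝ φ (x + t • y) y = inner ℝ (gradient φ (x + t • y)) y := by simp [gradient]
  simp only [e, ← ofReal_norm]
  rw [← ENNReal.ofReal_mul (norm_nonneg _)]
  exact ENNReal.ofReal_le_ofReal (norm_inner_le_norm _ _)

lemma lintegral_comp_add_smul {g : EuclideanSpace ℝ (Fin N) → ENNReal} (hg : Measurable g)
    (x : EuclideanSpace ℝ (Fin N)) {t : ℝ} (ht : 0 < t) :
    ∫⁻ y, g (x + t • y) = ENNReal.ofReal ((t ^ N)⁻¹) * ∫⁻ y, g y := by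
  have h := lintegral_map (μ := (volume : Measure (EuclideanSpace ℝ (Fin N))))
    (f := fun z => g (x + z)) (g := fun y => t • y)
    (hg.comp (measurable_const_add x)) (measurable_const_smul t)
  rw [← h, Measure.map_addHaar_smul _ ht.ne', lintegral_smul_measure, lintegral_add_left_eq_self]
  simp [abs_of_pos ht]

/-- Bounding the integral of `y ↦ |∇φ(x + t y)|` over `A` by the `L^m` norm of `∇φ`
costs a factor `t ^ (-N / m)`: Hölder's inequality on `A`, then the substitution `z = x + t y`. -/
lemma lintegral_gradient_comp_le {φ : EuclideanSpace ℝ (Fin N) → ℝ} (hφ : IsTestFunction Ω φ)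
    {m : ℝ} (hm : 1 ≤ m) (A : Set (EuclideanSpace ℝ (Fin N)))
    (x : EuclideanSpace ℝ (Fin N)) {t : ℝ} (ht : 0 < t) :
    ∫⁻ y in A, ‖gradient φ (x + t • y)‖ₑ ≤
      ENNReal.ofReal (t ^ (-(N / m) : ℝ)) *
        (eLpNorm (gradient φ) (ENNReal.ofReal m) (volume.restrict Ω) *
          volume A ^ (1 - 1 / m : ℝ)) := by
  have hm0 : 0 < m := by linarith
  have hm' : (1 : ENNReal) ≤ ENNReal.ofReal m := by simpa using ENNReal.ofReal_le_ofReal hm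
  have hcont : Continuous fun y => gradient φ (x + t • y) :=
    hφ.continuous_gradient.comp (by fun_prop)
  have hscale : eLpNorm (fun y => gradient φ (x + t • y)) (ENNReal.ofReal m) volume
      = ENNReal.ofReal (t ^ (-(N / m) : ℝ)) *
        eLpNorm (gradient φ) (ENNReal.ofReal m) (volume.restrict Ω) := by
    have hs : Function.support (gradient φ) ⊆ Ω := fun y hy => by
      by_contra h
      exact hy (hφ.gradient_eq_zero h)
    rw [eLpNorm_restrict_eq_of_support_subset hs,
      eLpNorm_eq_lintegral_rpow_enorm_toReal (by simpa using hm0) ENNReal.ofReal_ne_top,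
      eLpNorm_eq_lintegral_rpow_enorm_toReal (by simpa using hm0) ENNReal.ofReal_ne_top,
      ENNReal.toReal_ofReal hm0.le,
      lintegral_comp_add_smul (g := fun z => ‖gradient φ z‖ₑ ^ m)
        (hφ.continuous_gradient.enorm.measurable.pow_const m) x ht,
      ENNReal.mul_rpow_of_nonneg _ _ (by positivity),
      ENNReal.ofReal_rpow_of_nonneg (by positivity) (by positivity)]
    congr 2
    rw [Real.inv_rpow (by positivity), ← Real.rpow_natCast, ← Real.rpow_mul ht.le,
      Real.rpow_neg ht.le, mul_one_div]
  have h1 := eLpNorm_le_eLpNorm_mul_rpow_measure_univ (μ := volume.restrict A) hm'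
    hcont.aestronglyMeasurable
  rw [eLpNorm_one_eq_lintegral_enorm, ENNReal.toReal_one, ENNReal.toReal_ofReal hm0.le,
    Measure.restrict_apply_univ, div_one] at h1
  refine h1.trans ?_
  rw [← mul_assoc, ← hscale]
  gcongr
  exact Measure.restrict_le_self

/-- **Morrey's bound** for test functions of a bounded open set. If `x ∈ Ω`, then `φ` vanishes on
`x + A` for a ball `A` that is chosen once and for all. Averaging `|φ(x + y) - φ(x)|` over `y ∈ A`
leads to the integral of `t ^ (-N / m)` over `(0, 1)`, which is finite because `m > N`. -/
theorem exists_enorm_le_mul_eLpNorm_gradient (hN : 1 ≤ N) (hΩ : Bornology.IsBounded Ω) {m : ℝ}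
    (hm : (N : ℝ) < m) :
    ∃ C : ENNReal, C ≠ ⊤ ∧ ∀ φ, IsTestFunction Ω φ → ∀ x : EuclideanSpace ℝ (Fin N),
      ‖φ x‖ₑ ≤ C * eLpNorm (gradient φ) (ENNReal.ofReal m) (volume.restrict Ω) := by
  have hN' : (1 : ℝ) ≤ N := by exact_mod_cast hN
  have hm1 : 1 ≤ m := by linarith
  have hm0 : 0 < m := by linarith
  obtain ⟨R, hR0, hR⟩ := hΩ.exists_pos_norm_lt
  have : Nonempty (Fin N) := ⟨⟨0, hN⟩⟩
  -- `Ω` lies in the ball of radius `R` about `0`, so translating by vectors of length at least `2 R`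
  -- leads out of `Ω`.
  obtain ⟨c, hc⟩ := exists_norm_eq (EuclideanSpace ℝ (Fin N)) (c := 2 * R + 1) (by positivity)
  set A := Metric.ball c 1 with hA
  have hAm : MeasurableSet A := measurableSet_ball
  have hA0 : volume A ≠ 0 := (Metric.measure_ball_pos volume c one_pos).ne'
  have hAtop : volume A ≠ ⊤ := measure_ball_lt_top.ne
  set L : ENNReal := ENNReal.ofReal (2 * R + 2) with hL
  set I : ENNReal := ∫⁻ t in Ioc (0 : ℝ) 1, ENNReal.ofReal (t ^ (-(N / m) : ℝ)) with hI
  have hItop : I ≠ ⊤ := by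
    have hlt : (N : ℝ) / m < 1 := (div_lt_one hm0).2 hm
    have h := (intervalIntegral.intervalIntegrable_rpow' (a := 0) (b := 1)
      (r := -(N / m)) (by linarith)).1
    exact h.lintegral_lt_top.ne
  refine ⟨(volume A)⁻¹ * (L * (I * volume A ^ (1 - 1 / m : ℝ))), ?_, fun φ hφ x => ?_⟩
  · refine ENNReal.mul_ne_top (ENNReal.inv_ne_top.2 hA0) (ENNReal.mul_ne_top
      ENNReal.ofReal_ne_top (ENNReal.mul_ne_top hItop (ENNReal.rpow_ne_top_of_nonneg ?_ hAtop)))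
    rw [sub_nonneg, div_le_one hm0]
    exact hm1
  by_cases hx : x ∈ Ω
  swap
  · simp [hφ.eq_zero hx]
  set K := eLpNorm (gradient φ) (ENNReal.ofReal m) (volume.restrict Ω) with hK
  have hpt : ∀ y ∈ A, ‖φ x‖ₑ ≤ ∫⁻ t in Ioc (0 : ℝ) 1, ‖gradient φ (x + t • y)‖ₑ * L := by
    intro y hy
    have hyc : ‖y - c‖ < 1 := by simpa [hA, dist_eq_norm] using hy
    have hlow : 2 * R < ‖y‖ := by
      have := norm_sub_norm_le c y
      rw [norm_sub_rev] at this
      linarith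
    have hup : ‖y‖ ≤ 2 * R + 2 := by
      have := norm_sub_norm_le y c
      linarith
    have hout : x + y ∉ Ω := fun h => by
      have h1 := hR _ h
      have h2 := hR _ hx
      have h3 := norm_sub_le (x + y) x
      rw [add_sub_cancel_left] at h3
      linarith
    have h := enorm_sub_le_lintegral_gradient (hφ.1.of_le (by simp)) x y
    rw [hφ.eq_zero hout, zero_sub, enorm_neg] at h
    refine h.trans (lintegral_mono fun t => ?_)
    gcongr
    rw [hL, ← ofReal_norm]
    exact ENNReal.ofReal_le_ofReal hup
  have hmeas : Measurable fun z : EuclideanSpace ℝ (Fin N) × ℝ =>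
      ‖gradient φ (x + z.2 • z.1)‖ₑ * L :=
    ((hφ.continuous_gradient.comp (by fun_prop)).enorm.measurable).mul_const L
  have hmain : volume A * ‖φ x‖ₑ ≤ L * (I * volume A ^ (1 - 1 / m : ℝ)) * K := by
    calc volume A * ‖φ x‖ₑ = ∫⁻ _ in A, ‖φ x‖ₑ := by rw [setLIntegral_const, mul_comm]
      _ ≤ ∫⁻ y in A, ∫⁻ t in Ioc (0 : ℝ) 1, ‖gradient φ (x + t • y)‖ₑ * L :=
        setLIntegral_mono' hAm hpt
      _ = ∫⁻ t in Ioc (0 : ℝ) 1, ∫⁻ y in A, ‖gradient φ (x + t • y)‖ₑ * L :=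
        lintegral_lintegral_swap hmeas.aemeasurable
      _ ≤ ∫⁻ t in Ioc (0 : ℝ) 1, ENNReal.ofReal (t ^ (-(N / m) : ℝ)) *
          (K * volume A ^ (1 - 1 / m : ℝ) * L) := by
        refine setLIntegral_mono' measurableSet_Ioc fun t ht => ?_
        rw [lintegral_mul_const' _ _ ENNReal.ofReal_ne_top, ← mul_assoc]
        gcongr
        exact lintegral_gradient_comp_le hφ hm1 A x ht.1
      _ = L * (I * volume A ^ (1 - 1 / m : ℝ)) * K := by
        rw [lintegral_mul_const _ (by fun_prop)]
        ring
  calc ‖φ x‖ₑ = (volume A)⁻¹ * (volume A * ‖φ x‖ₑ) := by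
        rw [← mul_assoc, ENNReal.inv_mul_cancel hA0 hAtop, one_mul]
    _ ≤ (volume A)⁻¹ * (L * (I * volume A ^ (1 - 1 / m : ℝ)) * K) := by gcongr
    _ = _ := by ring

/-! ### Continuous representatives -/

/-- The representative of an element of `W₀^{1,m}(Ω)` that is continuous on the whole space and
vanishes outside `Ω`. -/
structure IsZeroExtension (Ω : Set (EuclideanSpace ℝ (Fin N)))
    (u w : EuclideanSpace ℝ (Fin N) → ℝ) : Prop where
  continuous : Continuous w
  eq_zero : ∀ x ∉ Ω, w x = 0
  ae_eq : w =ᵐ[volume.restrict Ω] u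

/-- By Morrey's bound, test functions that converge in `W^{1,m}` converge uniformly. -/
lemma exists_tendstoUniformly (hN : 1 ≤ N) (hb : Bornology.IsBounded Ω) {m : ℝ}
    (hm : (N : ℝ) < m) {u : EuclideanSpace ℝ (Fin N) → ℝ} (hu : u ∈ sobolevZero Ω m) :
    ∃ (φ : ℕ → EuclideanSpace ℝ (Fin N) → ℝ) (w : EuclideanSpace ℝ (Fin N) → ℝ),
      (∀ n, IsTestFunction Ω (φ n)) ∧
      Tendsto (fun n => eLpNorm (fun x => gradient (φ n) x - weakGrad Ω u x)
        (ENNReal.ofReal m) (volume.restrict Ω)) atTop (𝓝 0) ∧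
      TendstoUniformly φ w atTop ∧ IsZeroExtension Ω u w := by
  have hN' : (1 : ℝ) ≤ N := by exact_mod_cast hN
  have hm0 : 0 < m := by linarith
  have hm' : (1 : ENNReal) ≤ ENNReal.ofReal m := by
    simpa using ENNReal.ofReal_le_ofReal (by linarith : 1 ≤ m)
  obtain ⟨C, hC, hCφ⟩ := exists_enorm_le_mul_eLpNorm_gradient hN hb hm
  obtain ⟨hu1, -, hu2, φ, hφ, hφ1, hφ2⟩ := hu
  set a : ℕ → ENNReal := fun n => eLpNorm (fun x => gradient (φ n) x - weakGrad Ω u x)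
        (ENNReal.ofReal m) (volume.restrict Ω) with ha
  have hsub : ∀ n k x, ‖φ n x - φ k x‖ₑ ≤ C * (a n + a k) := by
    intro n k x
    have ht : IsTestFunction Ω (fun y => φ n y + (-1) * φ k y) := (hφ n).add ((hφ k).const_mul _)
    have h := hCφ _ ht x
    have e : φ n x + (-1) * φ k x = φ n x - φ k x := by ring
    simp only [e] at h
    refine h.trans ?_
    gcongr
    refine le_trans (le_of_eq (congrArg (eLpNorm · _ _) ?_))
      (eLpNorm_sub_le (((hφ n).memLp_gradient _).sub hu2).1
        (((hφ k).memLp_gradient _).sub hu2).1 hm')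
    ext1 y
    rw [(hφ n).gradient_add ((hφ k).const_mul _), (hφ k).gradient_const_mul]
    simp only [Pi.sub_apply, neg_smul, one_smul]
    abel
  have hCa : Tendsto (fun n : ℕ × ℕ => C * (a n.1 + a n.2)) (atTop ×ˢ atTop) (𝓝 0) := by
    have h := ENNReal.Tendsto.const_mul (a := C)
      ((hφ2.comp tendsto_fst).add (hφ2.comp (tendsto_snd (f := (atTop : Filter ℕ)))))
      (Or.inr hC)
    simpa using h
  have hcauchy : UniformCauchySeqOn φ atTop univ := by
    intro U hU
    obtain ⟨ε, hε, hεU⟩ := _root_.mem_uniformity_edist.1 hU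
    filter_upwards [hCa.eventually_lt_const hε] with n hn x _
    refine hεU ?_
    rw [edist_eq_enorm_sub]
    exact (hsub n.1 n.2 x).trans_lt hn
  have hlim : ∀ x, ∃ l, Tendsto (fun n => φ n x) atTop (𝓝 l) := fun x =>
    cauchySeq_tendsto_of_complete (hcauchy.cauchySeq (mem_univ x))
  choose w hw using hlim
  have hunif : TendstoUniformly φ w atTop :=
    tendstoUniformlyOn_univ.1 (hcauchy.tendstoUniformlyOn_of_tendsto fun x _ => hw x)
  refine ⟨φ, w, hφ, hφ2, hunif, ?_, fun x hx => ?_, ?_⟩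
  · exact hunif.continuous (Frequently.of_forall fun n => (hφ n).1.continuous)
  · refine tendsto_nhds_unique (hw x) ?_
    simp only [(hφ _).eq_zero hx]
    exact tendsto_const_nhds
  · obtain ⟨ns, hns, h⟩ := (tendstoInMeasure_of_tendsto_eLpNorm (by simpa using hm0)
      (fun n => ((hφ n).memLp 1).1) hu1.1 hφ1).exists_seq_tendsto_ae
    filter_upwards [h] with x hx
    exact tendsto_nhds_unique ((hw x).comp hns.tendsto_atTop) hx

lemma IsTestFunction.isZeroExtension {φ : EuclideanSpace ℝ (Fin N) → ℝ}
    (hφ : IsTestFunction Ω φ) : IsZeroExtension Ω φ φ :=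
  ⟨hφ.1.continuous, fun _ hx => hφ.eq_zero hx, EventuallyEq.rfl⟩

lemma exists_isZeroExtension (hN : 1 ≤ N) (hb : Bornology.IsBounded Ω) {m : ℝ}
    (hm : (N : ℝ) < m) {u : EuclideanSpace ℝ (Fin N) → ℝ} (hu : u ∈ sobolevZero Ω m) :
    ∃ w, IsZeroExtension Ω u w :=
  let ⟨_, w, _, _, _, hw⟩ := exists_tendstoUniformly hN hb hm hu
  ⟨w, hw⟩

/-- A function in `W₀^{1,m}(Ω)` whose weak gradient vanishes is zero. -/
lemma isZeroOn_of_weakGrad_ae_eq_zero (hN : 1 ≤ N) (hb : Bornology.IsBounded Ω) {m : ℝ} (hm : (N : ℝ) < m)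
    {u : EuclideanSpace ℝ (Fin N) → ℝ} (hu : u ∈ sobolevZero Ω m)
    (h0 : weakGrad Ω u =ᵐ[volume.restrict Ω] 0) : IsZeroOn Ω u := by
  obtain ⟨C, hC, hCφ⟩ := exists_enorm_le_mul_eLpNorm_gradient hN hb hm
  obtain ⟨φ, w, hφ, hφ2, hunif, hw⟩ := exists_tendstoUniformly hN hb hm hu
  have hw0 : ∀ x, w x = 0 := fun x => by
    have h1 : Tendsto (fun n => ‖φ n x‖ₑ) atTop (𝓝 ‖w x‖ₑ) := (hunif.tendsto_at x).enorm
    have h2 := ENNReal.Tendsto.const_mul (a := C) hφ2 (Or.inr hC)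
    rw [mul_zero] at h2
    have h3 := le_of_tendsto_of_tendsto' h1 h2 fun n => (hCφ _ (hφ n) x).trans <| by
      gcongr
      refine le_of_eq (eLpNorm_congr_ae ?_)
      filter_upwards [h0] with y hy
      simp [hy]
    simpa using h3
  filter_upwards [hw.ae_eq] with x hx
  rw [← hx, hw0 x, Pi.zero_apply]

namespace IsZeroExtension

variable {u v w z : EuclideanSpace ℝ (Fin N) → ℝ}

lemma isContRep (hw : IsZeroExtension Ω u w) : IsContRep Ω u w :=
  ⟨hw.continuous.continuousOn, hw.ae_eq⟩

lemma add (hw : IsZeroExtension Ω u w) (hz : IsZeroExtension Ω v z) :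
    IsZeroExtension Ω (fun x => u x + v x) (fun x => w x + z x) :=
  ⟨hw.continuous.add hz.continuous, fun x hx => by simp [hw.eq_zero x hx, hz.eq_zero x hx],
    hw.ae_eq.add hz.ae_eq⟩

lemma const_mul (hw : IsZeroExtension Ω u w) (c : ℝ) :
    IsZeroExtension Ω (fun x => c * u x) (fun x => c * w x) :=
  ⟨continuous_const.mul hw.continuous, fun x hx => by simp [hw.eq_zero x hx],
    hw.ae_eq.fun_comp (c * ·)⟩

lemma eLpNorm_top_le (hw : IsZeroExtension Ω u w) {M : ℝ} (h : ∀ x, |w x| ≤ M) :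
    eLpNorm u ⊤ (volume.restrict Ω) ≤ ENNReal.ofReal M := by
  rw [← eLpNorm_congr_ae hw.ae_eq, eLpNorm_exponent_top]
  refine eLpNormEssSup_le_of_ae_bound (.of_forall h)

/-- The representative attains its maximal modulus. -/
lemma exists_forall_abs_le (hw : IsZeroExtension Ω u w) (hb : Bornology.IsBounded Ω) :
    ∃ x₁, ∀ x, |w x| ≤ |w x₁| := by
  have hc : HasCompactSupport w := by
    refine HasCompactSupport.intro hb.isCompact_closure fun x hx => ?_
    exact hw.eq_zero x fun h => hx (subset_closure h)
  obtain ⟨x₁, h⟩ := (hw.continuous.abs).exists_forall_ge_of_hasCompactSupport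
    (hc.comp_left (g := fun y => |y|) abs_zero)
  exact ⟨x₁, h⟩

lemma eLpNorm_top_ne_top (hw : IsZeroExtension Ω u w) (hb : Bornology.IsBounded Ω) :
    eLpNorm u ⊤ (volume.restrict Ω) ≠ ⊤ := by
  obtain ⟨x₁, h⟩ := hw.exists_forall_abs_le hb
  exact ((hw.eLpNorm_top_le h).trans_lt ENNReal.ofReal_lt_top).ne

lemma abs_le_supNorm (hw : IsZeroExtension Ω u w) (hΩ : IsOpen Ω) (hb : Bornology.IsBounded Ω)
    (x : EuclideanSpace ℝ (Fin N)) : |w x| ≤ supNorm Ω u := by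
  by_cases hx : x ∈ Ω
  swap
  · rw [hw.eq_zero x hx, abs_zero]
    exact ENNReal.toReal_nonneg
  by_contra! hlt
  have hopen : IsOpen (Ω ∩ {y | supNorm Ω u < |w y|}) :=
    hΩ.inter (isOpen_lt continuous_const hw.continuous.abs)
  have hae : ∀ᵐ y ∂volume.restrict Ω, |w y| ≤ supNorm Ω u := by
    filter_upwards [ae_le_eLpNormEssSup (f := u) (μ := volume.restrict Ω), hw.ae_eq] with y hy hy'
    rw [hy', ← Real.norm_eq_abs, ← toReal_enorm]
    exact ENNReal.toReal_mono (hw.eLpNorm_top_ne_top hb) (by rwa [eLpNorm_exponent_top])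
  rw [ae_restrict_iff' hΩ.measurableSet] at hae
  have hnull : volume (Ω ∩ {y | supNorm Ω u < |w y|}) = 0 := by
    refine measure_mono_null (fun y hy => ?_) (ae_iff.1 hae)
    simpa using hy
  rw [hopen.measure_eq_zero_iff volume] at hnull
  exact (hnull ▸ (⟨hx, hlt⟩ : x ∈ Ω ∩ {y | supNorm Ω u < |w y|}) : x ∈ (∅ : Set _))

lemma exists_abs_eq_supNorm (hw : IsZeroExtension Ω u w) (hΩ : IsOpen Ω)
    (hb : Bornology.IsBounded Ω) : ∃ x₀, |w x₀| = supNorm Ω u := by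
  obtain ⟨x₁, h⟩ := hw.exists_forall_abs_le hb
  refine ⟨x₁, le_antisymm (hw.abs_le_supNorm hΩ hb x₁) ?_⟩
  exact ENNReal.toReal_le_of_le_ofReal (abs_nonneg _) (hw.eLpNorm_top_le h)

lemma mem_of_abs_eq_supNorm (hw : IsZeroExtension Ω u w) (h0 : 0 < supNorm Ω u)
    {x : EuclideanSpace ℝ (Fin N)} (hx : |w x| = supNorm Ω u) : x ∈ Ω := by
  by_contra h
  rw [hw.eq_zero x h, abs_zero] at hx
  exact h0.ne hx

lemma supNorm_pos (hw : IsZeroExtension Ω u w) (hb : Bornology.IsBounded Ω)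
    (h0 : ¬ IsZeroOn Ω u) : 0 < supNorm Ω u := by
  refine ENNReal.toReal_pos (fun h => h0 ?_) (hw.eLpNorm_top_ne_top hb)
  rw [eLpNorm_exponent_top] at h
  exact eLpNormEssSup_eq_zero_iff.1 h

end IsZeroExtension

lemma supNorm_nonneg (u : EuclideanSpace ℝ (Fin N) → ℝ) : 0 ≤ supNorm Ω u :=
  ENNReal.toReal_nonneg

lemma gradNorm_nonneg (s : ℝ) (u : EuclideanSpace ℝ (Fin N) → ℝ) : 0 ≤ gradNorm Ω s u :=
  ENNReal.toReal_nonneg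

lemma supNorm_const_mul (c : ℝ) (u : EuclideanSpace ℝ (Fin N) → ℝ) :
    supNorm Ω (fun x => c * u x) = |c| * supNorm Ω u := by
  have : (fun x => c * u x) = c • u := rfl
  rw [supNorm, this, eLpNorm_const_smul, ENNReal.toReal_mul, toReal_enorm, Real.norm_eq_abs,
    supNorm]

lemma gradNorm_const_mul (hΩ : IsOpen Ω) {m : ℝ} {u : EuclideanSpace ℝ (Fin N) → ℝ}
    (hu : u ∈ sobolevZero Ω m) (s c : ℝ) :
    gradNorm Ω s (fun x => c * u x) = |c| * gradNorm Ω s u := by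
  have : (fun x => c • weakGrad Ω u x) = c • weakGrad Ω u := rfl
  rw [gradNorm, eLpNorm_congr_ae (weakGrad_const_mul hΩ hu c), this, eLpNorm_const_smul,
    ENNReal.toReal_mul, toReal_enorm, Real.norm_eq_abs, gradNorm]

lemma lambdaInf_nonneg (m : ℝ) : 0 ≤ lambdaInf Ω m := by
  refine Real.sInf_nonneg ?_
  rintro c ⟨v, -, -, rfl⟩
  exact div_nonneg (Real.rpow_nonneg (gradNorm_nonneg _ _) _)
    (Real.rpow_nonneg (supNorm_nonneg _) _)

/-- A value of the parameter above `λ_∞(m)` exceeds the quotient of some test function. -/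
lemma exists_isTestFunction_of_lambdaInf_lt (hN : 1 ≤ N) (hΩ : IsOpen Ω)
    (hne : Ω.Nonempty)
    (hb : Bornology.IsBounded Ω) {m lam : ℝ} (hm : (N : ℝ) < m) (hlam : lambdaInf Ω m < lam) :
    ∃ φ, IsTestFunction Ω φ ∧ gradNorm Ω m φ ^ m < lam * supNorm Ω φ ^ m := by
  have hm0 : 0 < m := lt_of_le_of_lt (Nat.cast_nonneg N) hm
  have hm' : (1 : ENNReal) ≤ ENNReal.ofReal m := by
    have hN' : (1 : ℝ) ≤ N := by exact_mod_cast hN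
    simpa using ENNReal.ofReal_le_ofReal (by linarith : 1 ≤ m)
  have hset : {c | ∃ v ∈ sobolevZero Ω m, ¬ IsZeroOn Ω v ∧
      c = gradNorm Ω m v ^ m / supNorm Ω v ^ m}.Nonempty := by
    obtain ⟨x, hx⟩ := hne
    have : Nonempty (Fin N) := ⟨⟨0, hN⟩⟩
    obtain ⟨y, hy⟩ := exists_ne x
    obtain ⟨φ, hφ, hφx, -⟩ := IsTestFunction.exists_separating hΩ hx hy.symm
    refine ⟨_, φ, hφ.mem_sobolevZero hΩ m, fun h => ?_, rfl⟩
    have h1 := hφ.isZeroExtension.abs_le_supNorm hΩ hb x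
    rw [supNorm, eLpNorm_congr_ae h, eLpNorm_zero, hφx] at h1
    norm_num at h1
  obtain ⟨_, ⟨v, hv, hv0, rfl⟩, hlt⟩ := exists_lt_of_csInf_lt hset hlam
  obtain ⟨φ, w, hφ, hφ2, hunif, hw⟩ := exists_tendstoUniformly hN hb hm hv
  obtain ⟨x₀, hx₀⟩ := hw.exists_abs_eq_supNorm hΩ hb
  rw [div_lt_iff₀ (Real.rpow_pos_of_pos (hw.supNorm_pos hb hv0) _), ← hx₀] at hlt
  have h1 : Tendsto (fun n => lam * |φ n x₀| ^ m) atTop (𝓝 (lam * |w x₀| ^ m)) :=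
    ((hunif.tendsto_at x₀).abs.rpow_const (Or.inr hm0.le)).const_mul lam
  have h2 : Tendsto (fun n => (eLpNorm (fun x => gradient (φ n) x - weakGrad Ω v x)
        (ENNReal.ofReal m) (volume.restrict Ω) + eLpNorm (weakGrad Ω v)
        (ENNReal.ofReal m) (volume.restrict Ω)).toReal ^ m) atTop (𝓝 (gradNorm Ω m v ^ m)) := by
    refine Tendsto.rpow_const ?_ (Or.inr hm0.le)
    refine (ENNReal.tendsto_toReal hv.2.2.1.eLpNorm_ne_top).comp ?_
    simpa using hφ2.add_const (eLpNorm (weakGrad Ω v) (ENNReal.ofReal m) (volume.restrict Ω))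
  obtain ⟨n, hn, hfin⟩ := ((h2.eventually_lt h1 hlt).and
    (hφ2.eventually_lt_const ENNReal.zero_lt_top)).exists
  have hlam0 : 0 < lam := (lambdaInf_nonneg m).trans_lt hlam
  refine ⟨φ n, hφ n, lt_of_le_of_lt ?_ (hn.trans_le ?_)⟩
  · refine Real.rpow_le_rpow (gradNorm_nonneg _ _) ?_ hm0.le
    refine ENNReal.toReal_mono (ENNReal.add_ne_top.2 ⟨hfin.ne, hv.2.2.1.eLpNorm_ne_top⟩) ?_
    rw [eLpNorm_congr_ae ((hφ n).isWeakGradient.weakGrad_ae_eq hΩ)]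
    refine le_trans (le_of_eq (congrArg (eLpNorm · _ _) ?_))
      (eLpNorm_add_le (((hφ n).memLp_gradient _).sub hv.2.2.1).1 hv.2.2.1.1 hm')
    ext1 y
    simp
  · have := (hφ n).isZeroExtension.abs_le_supNorm hΩ hb x₀
    gcongr

/-! ### The derivative of the Dirichlet energies -/

/-- Differentiation under the integral sign. The derivative is dominated by
`s (|a| + |b|) ^ s` as long as `|t| < 1`. -/
lemma hasDerivAt_integral_norm_add_smul_rpow {α F : Type*} [MeasurableSpace α] {μ : Measure α}
    [NormedAddCommGroup F] [InnerProductSpace ℝ F] {s : ℝ} (hs : 1 < s) {a b : α → F}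
    (ha : MemLp a (ENNReal.ofReal s) μ) (hb : MemLp b (ENNReal.ofReal s) μ) :
    Integrable (fun x => ‖a x‖ ^ (s - 2) * inner ℝ (a x) (b x)) μ ∧
      HasDerivAt (fun t : ℝ => ∫ x, ‖a x + t • b x‖ ^ s ∂μ)
        (s * ∫ x, ‖a x‖ ^ (s - 2) * inner ℝ (a x) (b x) ∂μ) 0 := by
  have hs0 : 0 < s := by linarith
  have hint : ∀ {f : α → F}, MemLp f (ENNReal.ofReal s) μ → Integrable (fun x => ‖f x‖ ^ s) μ :=
    fun hf => by
      simpa [ENNReal.toReal_ofReal hs0.le] using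
        hf.integrable_norm_rpow (by simpa using hs0) ENNReal.ofReal_ne_top
  have hbound : Integrable (fun x => s * (‖a x‖ + ‖b x‖) ^ s) μ := by
    have h := (ha.norm.add hb.norm).integrable_norm_rpow (by simpa using hs0)
      ENNReal.ofReal_ne_top
    rw [ENNReal.toReal_ofReal hs0.le] at h
    refine (h.congr (.of_forall fun x => ?_)).const_mul s
    simp only [Pi.add_apply]
    rw [Real.norm_of_nonneg (by positivity)]
  have hder : ∀ x, ∀ t : ℝ, HasDerivAt (fun t : ℝ => ‖a x + t • b x‖ ^ s)
      (s * (‖a x + t • b x‖ ^ (s - 2) * inner ℝ (a x + t • b x) (b x))) t := fun x t => by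
    have h1 : HasDerivAt (fun t : ℝ => a x + t • b x) (b x) t := by
      simpa using ((hasDerivAt_id t).smul_const (b x)).const_add (a x)
    have h2 := (hasFDerivAt_norm_rpow (a x + t • b x) hs).comp_hasDerivAt t h1
    have e : s * (‖a x + t • b x‖ ^ (s - 2) * inner ℝ (a x + t • b x) (b x)) =
        ((s * ‖a x + t • b x‖ ^ (s - 2)) • innerSL ℝ (a x + t • b x)) (b x) := by
      rw [smul_apply, innerSL_apply_apply, smul_eq_mul, mul_assoc]
    rw [e]
    exact h2
  have hle : ∀ x, ∀ t ∈ Metric.ball (0 : ℝ) 1,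
      ‖s * (‖a x + t • b x‖ ^ (s - 2) * inner ℝ (a x + t • b x) (b x))‖
        ≤ s * (‖a x‖ + ‖b x‖) ^ s := fun x t ht => by
    have ht1 : |t| ≤ 1 := by simpa using (mem_ball_zero_iff.1 ht).le
    set c := a x + t • b x with hc
    have hcn : ‖c‖ ≤ ‖a x‖ + ‖b x‖ := by
      refine (norm_add_le _ _).trans ?_
      rw [norm_smul, Real.norm_eq_abs]
      gcongr
      exact mul_le_of_le_one_left (norm_nonneg _) ht1
    rw [norm_mul, norm_mul, Real.norm_of_nonneg hs0.le,
      Real.norm_of_nonneg (Real.rpow_nonneg (norm_nonneg _) _)]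
    refine mul_le_mul_of_nonneg_left ?_ hs0.le
    rcases eq_or_ne c 0 with h0 | h0
    · rw [h0, inner_zero_left, norm_zero (E := ℝ), mul_zero]
      positivity
    have hcpos : 0 < ‖c‖ := norm_pos_iff.2 h0
    calc ‖c‖ ^ (s - 2) * ‖inner ℝ c (b x)‖ ≤ ‖c‖ ^ (s - 2) * (‖c‖ * ‖b x‖) := by
          gcongr
          exact norm_inner_le_norm _ _
      _ = ‖c‖ ^ (s - 1) * ‖b x‖ := by
          rw [← mul_assoc, ← Real.rpow_add_one hcpos.ne']
          congr 2
          ring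
      _ ≤ (‖a x‖ + ‖b x‖) ^ (s - 1) * (‖a x‖ + ‖b x‖) := by
          refine mul_le_mul (Real.rpow_le_rpow (norm_nonneg _) hcn (by linarith))
            (le_add_of_nonneg_left (norm_nonneg _)) (norm_nonneg _) (by positivity)
      _ = (‖a x‖ + ‖b x‖) ^ s := by
          rw [← Real.rpow_add_one (hcpos.trans_le hcn).ne']
          congr 1
          ring
  have hmeas : ∀ t : ℝ, AEStronglyMeasurable (fun x => ‖a x + t • b x‖ ^ s) μ := fun t =>
    (hint (ha.add (hb.const_smul t))).1
  have hmeas' : AEStronglyMeasurable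
      (fun x => s * (‖a x + (0 : ℝ) • b x‖ ^ (s - 2) *
        inner ℝ (a x + (0 : ℝ) • b x) (b x))) μ := by
    have h0 : AEStronglyMeasurable (fun x => a x + (0 : ℝ) • b x) μ :=
      ha.1.add (hb.1.const_smul (0 : ℝ))
    exact (((h0.norm.aemeasurable.pow_const _).aestronglyMeasurable).mul
      (h0.inner hb.1)).const_mul s
  obtain ⟨h1, h2⟩ := hasDerivAt_integral_of_dominated_loc_of_deriv_le (𝕜 := ℝ) (x₀ := 0)
    (Metric.ball_mem_nhds (0 : ℝ) one_pos) (.of_forall hmeas)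
    (hint (ha.add (hb.const_smul (0 : ℝ)))) hmeas' (.of_forall hle) hbound
    (.of_forall fun x t _ => hder x t)
  simp only [zero_smul, add_zero] at h1 h2
  rw [integral_const_mul] at h2
  refine ⟨?_, h2⟩
  simpa [← mul_assoc, inv_mul_cancel₀ hs0.ne'] using h1.const_mul s⁻¹

lemma memLp_weakGrad (hb : Bornology.IsBounded Ω) {m s : ℝ} (hsm : s ≤ m)
    {u : EuclideanSpace ℝ (Fin N) → ℝ} (hu : u ∈ sobolevZero Ω m) :
    MemLp (weakGrad Ω u) (ENNReal.ofReal s) (volume.restrict Ω) := by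
  have : IsFiniteMeasure (volume.restrict Ω) := ⟨by simpa using hb.measure_lt_top⟩
  exact hu.2.2.1.mono_exponent (ENNReal.ofReal_le_ofReal hsm)

lemma gradNorm_rpow {s : ℝ} (hs : 0 < s) {u : EuclideanSpace ℝ (Fin N) → ℝ}
    (hu : MemLp (weakGrad Ω u) (ENNReal.ofReal s) (volume.restrict Ω)) :
    gradNorm Ω s u ^ s = ∫ x in Ω, ‖weakGrad Ω u x‖ ^ s := by
  rw [gradNorm, hu.eLpNorm_eq_integral_rpow_norm (by simpa using hs) ENNReal.ofReal_ne_top,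
    ENNReal.toReal_ofReal hs.le, ENNReal.toReal_ofReal (by positivity),
    Real.rpow_inv_rpow (by positivity) hs.ne']

/-- The derivative of `‖∇(u + t v)‖_s ^ s` at `t = 0`. -/
lemma hasDerivAt_gradNorm_rpow (hΩ : IsOpen Ω) (hb : Bornology.IsBounded Ω) {m s : ℝ}
    (hs : 1 < s) (hsm : s ≤ m) {u v : EuclideanSpace ℝ (Fin N) → ℝ}
    (hu : u ∈ sobolevZero Ω m) (hv : v ∈ sobolevZero Ω m) :
    IntegrableOn (fun x => ‖weakGrad Ω u x‖ ^ (s - 2) *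
        inner ℝ (weakGrad Ω u x) (weakGrad Ω v x)) Ω ∧
      HasDerivAt (fun t : ℝ => gradNorm Ω s (fun x => u x + t * v x) ^ s)
        (s * ∫ x in Ω, ‖weakGrad Ω u x‖ ^ (s - 2) *
          inner ℝ (weakGrad Ω u x) (weakGrad Ω v x)) 0 := by
  obtain ⟨h1, h2⟩ := hasDerivAt_integral_norm_add_smul_rpow hs (memLp_weakGrad hb hsm hu)
    (memLp_weakGrad hb hsm hv)
  refine ⟨h1, h2.congr_of_eventuallyEq (.of_forall fun t => ?_)⟩
  have hm : 1 ≤ m := hs.le.trans hsm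
  have htv := const_mul_mem_sobolevZero hΩ hv t
  dsimp only
  rw [gradNorm_rpow (by linarith) (memLp_weakGrad hb hsm (add_mem_sobolevZero hΩ hm hu htv))]
  refine integral_congr_ae ?_
  filter_upwards [weakGrad_add hΩ hu htv, weakGrad_const_mul hΩ hv t] with x h3 h4
  rw [h3, h4]

/-! ### Least energy solutions -/

section LeastEnergy

variable {p q lam : ℝ} {u : EuclideanSpace ℝ (Fin N) → ℝ}

/-- For `p < q` and `λ > λ_∞(p)` the energy takes negative values, since `t ^ q` is small compared
with `t ^ p` for small `t > 0`. So its minimizer is not zero. -/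
lemma supNorm_pos_of_isMinOn_energy (hN : 1 ≤ N) (hΩ : IsOpen Ω) (hne : Ω.Nonempty)
    (hb : Bornology.IsBounded Ω) (hp : (N : ℝ) < p) (hpq : p < q)
    (hlam : lambdaInf Ω p < lam) (hu : IsMinOn (energy Ω p q lam) (spaceX Ω p q) u) :
    0 < supNorm Ω u := by
  have hp0 : 0 < p := lt_of_le_of_lt (Nat.cast_nonneg N) hp
  have hq0 : 0 < q := hp0.trans hpq
  obtain ⟨φ, hφ, hlt⟩ := exists_isTestFunction_of_lambdaInf_lt hN hΩ hne hb hp hlam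
  have hlim : Tendsto (fun t : ℝ => t ^ (q - p) * (1 / q * gradNorm Ω q φ ^ q)) (𝓝[>] 0)
      (𝓝 0) := by
    have h : Tendsto (fun t : ℝ => t ^ (q - p)) (𝓝 0) (𝓝 (0 ^ (q - p))) :=
      (Real.continuousAt_rpow_const 0 (q - p) (Or.inr (by linarith))).tendsto
    rw [Real.zero_rpow (by linarith)] at h
    simpa using (h.mono_left nhdsWithin_le_nhds).mul_const (1 / q * gradNorm Ω q φ ^ q)
  have hpos : 0 < 1 / p * (lam * supNorm Ω φ ^ p - gradNorm Ω p φ ^ p) :=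
    mul_pos (by positivity) (sub_pos.2 hlt)
  obtain ⟨t, ht, ht0⟩ := ((hlim.eventually_lt_const hpos).and self_mem_nhdsWithin).exists
  have ht0 : 0 < t := ht0
  have hφX := hφ.mem_sobolevZero hΩ (max p q)
  have hE := isMinOn_iff.1 hu _ (const_mul_mem_sobolevZero hΩ hφX t)
  have hneg : energy Ω p q lam (fun x => t * φ x) < 0 := by
    have e : energy Ω p q lam (fun x => t * φ x) = t ^ p * (t ^ (q - p) *
        (1 / q * gradNorm Ω q φ ^ q) - 1 / p * (lam * supNorm Ω φ ^ p - gradNorm Ω p φ ^ p)) := by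
      have ht : t ^ q = t ^ p * t ^ (q - p) := by
        rw [← Real.rpow_add ht0]
        congr 1
        ring
      rw [energy, gradNorm_const_mul hΩ hφX, gradNorm_const_mul hΩ hφX, supNorm_const_mul,
        abs_of_pos ht0, Real.mul_rpow ht0.le (gradNorm_nonneg _ _),
        Real.mul_rpow ht0.le (gradNorm_nonneg _ _), Real.mul_rpow ht0.le (supNorm_nonneg _), ht]
      ring
    rw [e]
    exact mul_neg_of_pos_of_neg (Real.rpow_pos_of_pos ht0 _) (by linarith)
  refine (supNorm_nonneg u).lt_of_ne fun h0 => ?_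
  have hu0 : 0 ≤ energy Ω p q lam u := by
    rw [energy, ← h0, Real.zero_rpow hp0.ne', mul_zero, sub_zero]
    have := Real.rpow_nonneg (gradNorm_nonneg (Ω := Ω) p u) p
    have := Real.rpow_nonneg (gradNorm_nonneg (Ω := Ω) q u) q
    positivity
  linarith

/-- On the Nehari set the energy is a multiple of `‖∇u‖_q ^ q`. -/
lemma energy_eq_of_mem_nehari (hu : u ∈ nehari Ω p q lam) :
    energy Ω p q lam u = (1 / q - 1 / p) * gradNorm Ω q u ^ q := by
  have h : lam / p * supNorm Ω u ^ p = 1 / p * (lam * supNorm Ω u ^ p) := by ring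
  rw [energy, h, ← hu.2.2]
  ring

/-- For `q < p` every `v` with `‖∇v‖_p ^ p < λ ‖v‖_∞ ^ p` has a positive multiple `t v` in the
Nehari set. If `u` minimizes the energy there, then `‖∇u‖_q ^ q ≤ t ^ q ‖∇v‖_q ^ q`, which is the
following inequality for `d = λ ‖v‖_∞ ^ p - ‖∇v‖_p ^ p`; smaller `d` make it weaker. -/
lemma gradNorm_rpow_le_of_isMinOn_nehari (hΩ : IsOpen Ω) (hq0 : 0 < q) (hqp : q < p)
    (hu : u ∈ nehari Ω p q lam) (hmin : IsMinOn (energy Ω p q lam) (nehari Ω p q lam) u)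
    {v : EuclideanSpace ℝ (Fin N) → ℝ} (hv : v ∈ spaceX Ω p q) (hv0 : 0 < gradNorm Ω q v ^ q)
    {d : ℝ} (hd0 : 0 < d) (hd : d ≤ lam * supNorm Ω v ^ p - gradNorm Ω p v ^ p) :
    (gradNorm Ω q u ^ q) ^ (p - q) * d ^ q ≤ (gradNorm Ω q v ^ q) ^ p := by
  have hp0 : 0 < p := hq0.trans hqp
  have hpq0 : 0 < p - q := sub_pos.2 hqp
  set D := lam * supNorm Ω v ^ p - gradNorm Ω p v ^ p with hD
  have hD0 : 0 < D := hd0.trans_le hd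
  set Q := gradNorm Ω q v ^ q with hQ
  -- The Nehari equation for `t v` reads `t ^ q * Q = t ^ p * D`.
  set t := (Q / D) ^ (p - q)⁻¹ with ht
  have ht0 : 0 < t := by positivity
  have htpq : t ^ (p - q) = Q / D := Real.rpow_inv_rpow (by positivity) hpq0.ne'
  have hgrad : ∀ s, gradNorm Ω s (fun x => t * v x) ^ s = t ^ s * gradNorm Ω s v ^ s := fun s => by
    rw [gradNorm_const_mul hΩ hv, abs_of_pos ht0, Real.mul_rpow ht0.le (gradNorm_nonneg _ _)]
  have hsup : supNorm Ω (fun x => t * v x) ^ p = t ^ p * supNorm Ω v ^ p := by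
    rw [supNorm_const_mul, abs_of_pos ht0, Real.mul_rpow ht0.le (supNorm_nonneg _)]
  have hmem : (fun x => t * v x) ∈ nehari Ω p q lam := by
    refine ⟨const_mul_mem_sobolevZero hΩ hv t, fun h => ?_, ?_⟩
    · have h0 : supNorm Ω v = 0 := by
        have h1 : supNorm Ω (fun x => t * v x) = 0 := by
          rw [supNorm, eLpNorm_congr_ae h, eLpNorm_zero, ENNReal.toReal_zero]
        rw [supNorm_const_mul, mul_eq_zero, abs_eq_zero] at h1
        exact h1.resolve_left ht0.ne'
      rw [hD, h0, Real.zero_rpow hp0.ne', mul_zero, zero_sub] at hD0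
      linarith [Real.rpow_nonneg (gradNorm_nonneg (Ω := Ω) p v) p]
    · have htp : t ^ p = t ^ q * (Q / D) := by
        rw [← htpq, ← Real.rpow_add ht0]
        congr 1
        ring
      have hQD : Q = Q / D * D := (div_mul_cancel₀ _ hD0.ne').symm
      rw [hgrad, hgrad, hsup, htp, ← hQ]
      nth_rewrite 2 [hQD]
      rw [hD]
      ring
  have hle := isMinOn_iff.1 hmin _ hmem
  rw [energy_eq_of_mem_nehari hu, energy_eq_of_mem_nehari hmem, hgrad] at hle
  have hc : 0 < 1 / q - 1 / p := sub_pos.2 (one_div_lt_one_div_of_lt hq0 hqp)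
  have hle' := le_of_mul_le_mul_left hle hc
  have hQu : 0 ≤ gradNorm Ω q u ^ q := Real.rpow_nonneg (gradNorm_nonneg _ _) _
  have h1 := Real.rpow_le_rpow hQu hle' hpq0.le
  rw [← hQ, Real.mul_rpow (by positivity) (by positivity), ← Real.rpow_mul ht0.le, mul_comm q,
    Real.rpow_mul ht0.le, htpq, Real.div_rpow (by positivity) hD0.le] at h1
  calc (gradNorm Ω q u ^ q) ^ (p - q) * d ^ q
      ≤ (Q ^ q / D ^ q * Q ^ (p - q)) * D ^ q := by gcongr
    _ = Q ^ q * Q ^ (p - q) := by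
        have : D ^ q ≠ 0 := (Real.rpow_pos_of_pos hD0 _).ne'
        field_simp
    _ = Q ^ p := by
        rw [← Real.rpow_add hv0]
        congr 1
        ring

/-- The weak equation, for the Dirac mass at an arbitrary maximum point `x₀` of `|u|`. The
functional `v ↦ λ |v(x₀)| ^ p` lies below `λ ‖v‖_∞ ^ p` and agrees with it at `v = u`, so `u` is
still minimal when the latter is replaced by the former, which is differentiable. -/
lemma integral_eq_of_abs_eq_supNorm (hN : 1 ≤ N) (hΩ : IsOpen Ω) (hb : Bornology.IsBounded Ω)
    (hp : (N : ℝ) < p) (hq : (N : ℝ) < q) (hlam : 0 < lam)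
    (hu : IsLeastEnergySolution Ω p q lam u) {w : EuclideanSpace ℝ (Fin N) → ℝ}
    (hw : IsZeroExtension Ω u w) {x₀ : EuclideanSpace ℝ (Fin N)} (hx₀ : |w x₀| = supNorm Ω u)
    {v z : EuclideanSpace ℝ (Fin N) → ℝ} (hv : v ∈ spaceX Ω p q) (hz : IsZeroExtension Ω v z) :
    IntegrableOn (pqIntegrand Ω p q u v) Ω ∧
      ∫ x in Ω, pqIntegrand Ω p q u v x = lam * (|w x₀| ^ (p - 2) * w x₀ * z x₀) := by
  have hN' : (1 : ℝ) ≤ N := by exact_mod_cast hN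
  have hp1 : 1 < p := by linarith
  have hq1 : 1 < q := by linarith
  have hp0 : 0 < p := by linarith
  have hq0 : 0 < q := by linarith
  have huX : u ∈ spaceX Ω p q := by
    rcases hu with h | h
    exacts [h.2.1, h.2.1.1]
  obtain ⟨hIp, hdP⟩ := hasDerivAt_gradNorm_rpow hΩ hb hp1 (le_max_left p q) huX hv
  obtain ⟨hIq, hdQ⟩ := hasDerivAt_gradNorm_rpow hΩ hb hq1 (le_max_right p q) huX hv
  set A := ∫ x in Ω, ‖weakGrad Ω u x‖ ^ (p - 2) * inner ℝ (weakGrad Ω u x) (weakGrad Ω v x)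
  set B := ∫ x in Ω, ‖weakGrad Ω u x‖ ^ (q - 2) * inner ℝ (weakGrad Ω u x) (weakGrad Ω v x)
  have hpqI : pqIntegrand Ω p q u v = fun x =>
      ‖weakGrad Ω u x‖ ^ (p - 2) * inner ℝ (weakGrad Ω u x) (weakGrad Ω v x) +
      ‖weakGrad Ω u x‖ ^ (q - 2) * inner ℝ (weakGrad Ω u x) (weakGrad Ω v x) := by
    ext x
    rw [pqIntegrand, add_mul]
  refine ⟨hpqI ▸ hIp.add hIq, ?_⟩
  rw [hpqI, integral_add hIp hIq]
  change A + B = _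
  set P : ℝ → ℝ := fun t => gradNorm Ω p (fun x => u x + t * v x) ^ p with hP
  set Q : ℝ → ℝ := fun t => gradNorm Ω q (fun x => u x + t * v x) ^ q with hQ
  set S : ℝ → ℝ := fun t => |w x₀ + t * z x₀| ^ p with hS
  have hdS : HasDerivAt S (p * |w x₀| ^ (p - 2) * w x₀ * z x₀) 0 := by
    have h1 : HasDerivAt (fun t : ℝ => w x₀ + t * z x₀) (z x₀) 0 := by
      simpa using ((hasDerivAt_id (0 : ℝ)).mul_const (z x₀)).const_add (w x₀)
    have h2 := (hasDerivAt_abs_rpow (w x₀ + 0 * z x₀) hp1).comp (0 : ℝ) h1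
    rw [zero_mul, add_zero] at h2
    exact h2
  have hmemX : ∀ t : ℝ, (fun x => u x + t * v x) ∈ spaceX Ω p q := fun t =>
    add_mem_sobolevZero hΩ (hp1.le.trans (le_max_left p q)) huX
      (const_mul_mem_sobolevZero hΩ hv t)
  have hSle : ∀ t, S t ≤ supNorm Ω (fun x => u x + t * v x) ^ p := fun t =>
    Real.rpow_le_rpow (abs_nonneg _) ((hw.add (hz.const_mul t)).abs_le_supNorm hΩ hb x₀) hp0.le
  have hP0 : P 0 = gradNorm Ω p u ^ p := by simp [hP]
  have hQ0 : Q 0 = gradNorm Ω q u ^ q := by simp [hQ]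
  have hS0 : S 0 = supNorm Ω u ^ p := by simp [hS, hx₀]
  rcases hu with ⟨hpq, -, hmin⟩ | ⟨hqp, hun, hmin⟩
  · have hloc : IsLocalMin (fun t => 1 / p * P t + 1 / q * Q t - lam / p * S t) 0 := by
      refine .of_forall fun t => ?_
      have h1 := isMinOn_iff.1 hmin _ (hmemX t)
      have h2 : lam / p * S t ≤ lam / p * supNorm Ω (fun x => u x + t * v x) ^ p :=
        mul_le_mul_of_nonneg_left (hSle t) (by positivity)
      simp only [hP0, hQ0, hS0]
      simp only [energy] at h1
      linarith
    have h := hloc.hasDerivAt_eq_zero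
      (((hdP.const_mul (1 / p)).add (hdQ.const_mul (1 / q))).sub (hdS.const_mul (lam / p)))
    field_simp at h
    linarith
  · have hnz := hun.2.1
    -- If `‖∇u‖_q = 0`, then `u` is zero by Morrey's bound.
    have hQpos : 0 < Q 0 := by
      refine (hQ0 ▸ Real.rpow_nonneg (gradNorm_nonneg _ _) _ : 0 ≤ Q 0).lt_of_ne fun h0 => hnz ?_
      rw [hQ0, eq_comm, Real.rpow_eq_zero (gradNorm_nonneg _ _) hq0.ne'] at h0
      have hmem := memLp_weakGrad hb (le_max_right p q) huX
      rw [gradNorm, ENNReal.toReal_eq_zero_iff] at h0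
      exact isZeroOn_of_weakGrad_ae_eq_zero hN hb (hp.trans_le (le_max_left p q)) huX
        ((eLpNorm_eq_zero_iff hmem.1 (by simpa using hq0)).1
          (h0.resolve_right hmem.eLpNorm_ne_top))
    have hD0 : lam * S 0 - P 0 = Q 0 := by
      rw [hS0, hP0, hQ0, ← hun.2.2]
      ring
    have hdD := (hdS.const_mul lam).sub hdP
    have hD0' : ((fun t => lam * S t) - P) 0 = Q 0 := hD0
    have hloc : IsLocalMin (fun t => Q t ^ p - Q 0 ^ (p - q) * (lam * S t - P t) ^ q) 0 := by
      have h1 : ∀ᶠ t in 𝓝 0, 0 < Q t := hdQ.continuousAt.eventually_const_lt hQpos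
      have h2 : ∀ᶠ t in 𝓝 0, 0 < lam * S t - P t :=
        hdD.continuousAt.eventually_const_lt (by rwa [← hD0] at hQpos)
      filter_upwards [h1, h2] with t ht1 ht2
      have h3 := gradNorm_rpow_le_of_isMinOn_nehari hΩ hq0 hqp hun hmin (hmemX t) ht1 ht2
        (sub_le_sub_right (mul_le_mul_of_nonneg_left (hSle t) hlam.le) _)
      rw [← hQ0] at h3
      have h4 : Q 0 ^ (p - q) * Q 0 ^ q = Q 0 ^ p := by
        rw [← Real.rpow_add hQpos]
        congr 1
        ring
      rw [hD0, h4, sub_self]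
      exact sub_nonneg.2 h3
    -- As `λ S(0) - P(0) = Q(0)`, both terms of the derivative have the factor `p q Q(0) ^ (p - 1)`.
    have h := hloc.hasDerivAt_eq_zero ((hdQ.rpow_const (p := p) (Or.inl hQpos.ne')).sub
      ((hdD.rpow_const (p := q) (Or.inl (hD0'.trans_ne hQpos.ne'))).const_mul
        (Q 0 ^ (p - q))))
    rw [hD0'] at h
    have h4 : Q 0 ^ (p - q) * Q 0 ^ (q - 1) = Q 0 ^ (p - 1) := by
      rw [← Real.rpow_add hQpos]
      congr 1
      ring
    have h5 : p * q * Q 0 ^ (p - 1) * (A + B - lam * (|w x₀| ^ (p - 2) * w x₀ * z x₀)) = 0 := by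
      linear_combination h - p * q * (A - lam * (|w x₀| ^ (p - 2) * w x₀ * z x₀)) * h4
    have h6 : p * q * Q 0 ^ (p - 1) ≠ 0 := by positivity
    exact sub_eq_zero.1 ((mul_eq_zero.1 h5).resolve_left h6)

end LeastEnergy

end DiracPQ

theorem proposition3p2 {N : ℕ} (hN : 2 ≤ N) (Ω : Set (EuclideanSpace ℝ (Fin N)))
    (hΩ_open : IsOpen Ω) (hΩ_conn : IsConnected Ω) (hΩ_bdd : Bornology.IsBounded Ω)
    (p q : ℝ) (hp : (N : ℝ) < p) (hq : (N : ℝ) < q) (hpq : p ≠ q)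
    (lam : ℝ) (hlam : DiracPQ.lambdaInf Ω p < lam)
    (u : EuclideanSpace ℝ (Fin N) → ℝ) (hu : DiracPQ.IsLeastEnergySolution Ω p q lam u) :
    DiracPQ.IsWeakSolution Ω p q lam u ∧
      ∃ w, DiracPQ.IsContRep Ω u w ∧
        ∃ x₀ ∈ Ω, {y ∈ closure Ω | |w y| = DiracPQ.supNorm Ω u} = {x₀} := by
  have hN1 : 1 ≤ N := by omega
  have hm : (N : ℝ) < max p q := hp.trans_le (le_max_left p q)
  have hlam0 : 0 < lam := (DiracPQ.lambdaInf_nonneg p).trans_lt hlam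
  have huX : u ∈ DiracPQ.spaceX Ω p q := by
    rcases hu with h | h
    exacts [h.2.1, h.2.1.1]
  obtain ⟨w, hw⟩ := DiracPQ.exists_isZeroExtension hN1 hΩ_bdd hm huX
  have hpos : 0 < DiracPQ.supNorm Ω u := by
    rcases hu with h | h
    · exact DiracPQ.supNorm_pos_of_isMinOn_energy hN1 hΩ_open hΩ_conn.nonempty hΩ_bdd hp h.1
        hlam h.2.2
    · exact hw.supNorm_pos hΩ_bdd h.2.1.2.1
  obtain ⟨x₀, hx₀⟩ := hw.exists_abs_eq_supNorm hΩ_open hΩ_bdd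
  have hx₀Ω := hw.mem_of_abs_eq_supNorm hpos hx₀
  refine ⟨⟨huX, w, hw.isContRep, x₀, hx₀Ω, hx₀, fun v hv => ?_⟩, w, hw.isContRep, x₀, hx₀Ω, ?_⟩
  · obtain ⟨z, hz⟩ := DiracPQ.exists_isZeroExtension hN1 hΩ_bdd hm hv
    exact ⟨z, hz.isContRep, DiracPQ.integral_eq_of_abs_eq_supNorm hN1 hΩ_open hΩ_bdd hp hq hlam0 hu
      hw hx₀ hv hz⟩
  ext y
  refine ⟨fun hy => ?_, fun hy => ?_⟩
  swap
  · rw [mem_singleton_iff.1 hy]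
    exact ⟨subset_closure hx₀Ω, hx₀⟩
  by_contra hne
  -- The weak equations for the two maximum points contradict each other for a test function that
  -- separates these points.
  obtain ⟨φ, hφ, hφ1, hφ0⟩ := DiracPQ.IsTestFunction.exists_separating hΩ_open hx₀Ω
    (fun h => hne h.symm : x₀ ≠ y)
  have hφX := hφ.mem_sobolevZero hΩ_open (max p q)
  have h1 := (DiracPQ.integral_eq_of_abs_eq_supNorm hN1 hΩ_open hΩ_bdd hp hq hlam0 hu hw hx₀ hφX
    hφ.isZeroExtension).2
  have h2 := (DiracPQ.integral_eq_of_abs_eq_supNorm hN1 hΩ_open hΩ_bdd hp hq hlam0 hu hw hy.2 hφX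
    hφ.isZeroExtension).2
  rw [h1, hφ1, hφ0, mul_one, mul_zero, mul_zero] at h2
  have hw0 : 0 < |w x₀| := hx₀ ▸ hpos
  exact mul_ne_zero hlam0.ne' (mul_ne_zero (Real.rpow_pos_of_pos hw0 _).ne' (abs_pos.1 hw0)) h2
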